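/- Let $\mathcal{A}=(\mathcal{P},\mathcal{L},\mathcal{I})$ be a Desargues affine plane, that is, an incidence structure of points and lines such that: (1) any two distinct points lie on exactly one line; (2) for every line $\ell$ and every point $P\notin\ell$ there is exactly one line through $P$ that does not meet $\ell$; (3) there are three distinct non-collinear points; and Desargues' axiom holds: if the lines $AA'$, $BB'$, $CC'$, $AC$, $A'C'$ are pairwise distinct, the lines $AA'$, $BB'$, $CC'$ are parallel or pass through a common point, $AB\parallel A'B'$, $BC\parallel B'C'$, $AB\neq A'B'$ and $BC\neq B'C'$, then $AC\parallel A'C'$. (Lines are parallel if they are equal or disjoint.) Let $O\neq I$ be points and $\ell=\ell^{OI}$ the line through them. For points $A,B\in\ell$ and an auxiliary point $T\notin\ell$: * the sum $A+B$ is the intersection with $\ell$ of the line through $P_1$ parallel to $BT$, where $P_1$ is the intersection of the line through $T$ parallel to $\ell$ and the line through $A$ parallel to $OT$; * the product $A\cdot B$ is the intersection with $\ell$ of the line through $P_1$ parallel to $BT$, where $P_1$ is the intersection of the line through $A$ parallel to $IT$ and the line $OT$. Then the following holds. The points $A+B$ and $A\cdot B$ do not depend on $T$, and $(\ell,+,\cdot)$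 is a skew field with zero $O$ and unit $I$. Let $B,C\in\ell$ be distinct points, put $r_{BC}(X)=(B-C)^{-1}\cdot(X-C)$ for $X\in\ell$, computed in this skew field, and let $\mathcal{R}_3=\{r_{BC}(X) : X\in\ell\}$. The set $\mathcal{R}_3$ is closed under the addition and multiplication of points of $\ell$. With these operations it is a skew field: $(\mathcal{R}_3,+)$ is an abelian group with zero $r_{BC}(C)$, the non-zero elements of $\mathcal{R}_3$ form a group under multiplication with unit $r_{BC}(B)$, and both distributive laws hold. Moreover, $\mathcal{R}_3$ is a sub-skew-field of $(\ell,+,\cdot)$. -/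

import Mathlib

namespace DesarguesGeometry

universe u v

/-- An affine plane with points `P`, lines `L` and incidence `p ∈ l`. -/
class AffinePlane (P : Type u) (L : Type v) [Membership P L] : Prop where
  existsUnique_line : ∀ p q : P, p ≠ q → ∃! l : L, p ∈ l ∧ q ∈ l
  existsUnique_disjoint_line : ∀ (p : P) (l : L), p ∉ l →
    ∃! m : L, p ∈ m ∧ ∀ x : P, x ∈ l → x ∉ m
  exists_noncollinear : ∃ p q r : P, p ≠ q ∧ p ≠ r ∧ q ≠ r ∧
    ¬ ∃ l : L, p ∈ l ∧ q ∈ l ∧ r ∈ l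

variable {P : Type u} {L : Type v} [Membership P L]

/-- Two lines are parallel if they are equal or have no common point. -/
def Parallel (l m : L) : Prop := l = m ∨ ∀ x : P, x ∈ l → x ∉ m

/-- The points of the line `l`. -/
abbrev PointsOn (l : L) : Type u := {x : P // x ∈ l}

theorem Parallel.symm {l m : L} (h : Parallel l m) : Parallel m l := by
  rcases h with h | h
  · exact Or.inl h.symm
  · exact Or.inr fun x hm hl => h x hl hm

/-- Parallel lines with a common point are equal. -/
theorem Parallel.eq_of_mem {l m : L} (h : Parallel l m) {x : P} (hl : x ∈ l) (hm : x ∈ m) :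
    l = m := by
  rcases h with h | h
  · exact h
  · exact absurd hm (h x hl)

theorem ne_of_mem_of_notMem {l : L} {x t : P} (hx : x ∈ l) (ht : t ∉ l) : x ≠ t :=
  fun h => ht (h ▸ hx)

theorem not_parallel_of_mem {l m : L} {x t : P} (hl : x ∈ l) (hm : x ∈ m) (htm : t ∈ m)
    (htl : t ∉ l) : ¬ Parallel l m :=
  fun h => htl (h.eq_of_mem hl hm ▸ htm)

section Plane

variable [AffinePlane P L]

theorem existsUnique_parallel (l : L) (p : P) : ∃! m : L, p ∈ m ∧ Parallel l m := by
  by_cases hp : p ∈ l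
  · exact ⟨l, ⟨hp, Or.inl rfl⟩, fun m hm => (hm.2.eq_of_mem hp hm.1).symm⟩
  · obtain ⟨m, hm, hu⟩ := AffinePlane.existsUnique_disjoint_line p l hp
    refine ⟨m, ⟨hm.1, Or.inr hm.2⟩, fun n hn => hu n ⟨hn.1, ?_⟩⟩
    rcases hn.2 with h | h
    · exact absurd (h ▸ hn.1) hp
    · exact h

theorem Parallel.trans {l m n : L} (h₁ : Parallel l m) (h₂ : Parallel m n) : Parallel l n := by
  by_cases h : ∃ x : P, x ∈ l ∧ x ∈ n
  · obtain ⟨x, hl, hn⟩ := h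
    exact Or.inl ((existsUnique_parallel m x).unique ⟨hl, h₁.symm⟩ ⟨hn, h₂⟩)
  · exact Or.inr fun x hl hn => h ⟨x, hl, hn⟩

theorem existsUnique_meet {l m : L} (h : ¬ Parallel l m) : ∃! x : P, x ∈ l ∧ x ∈ m := by
  have h' : ∃ x : P, x ∈ l ∧ x ∈ m := by
    by_contra hx
    exact h (Or.inr fun x hl hm => hx ⟨x, hl, hm⟩)
  obtain ⟨x, hx⟩ := h'
  refine ⟨x, hx, fun y hy => ?_⟩
  by_contra hne
  exact h (Or.inl ((AffinePlane.existsUnique_line y x hne).unique ⟨hy.1, hx.1⟩ ⟨hy.2, hx.2⟩))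

/-- The line joining two distinct points. -/
noncomputable def join (L : Type v) [Membership P L] [AffinePlane P L] (p q : P) (h : p ≠ q) : L :=
  (AffinePlane.existsUnique_line (L := L) p q h).choose

theorem left_mem_join {p q : P} (h : p ≠ q) : p ∈ join L p q h :=
  (AffinePlane.existsUnique_line (L := L) p q h).choose_spec.1.1

theorem right_mem_join {p q : P} (h : p ≠ q) : q ∈ join L p q h :=
  (AffinePlane.existsUnique_line (L := L) p q h).choose_spec.1.2

/-- The line through `p` parallel to `l`. -/
noncomputable def parallelThrough (l : L) (p : P) : L := (existsUnique_parallel l p).choose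

theorem mem_parallelThrough (l : L) (p : P) : p ∈ parallelThrough l p :=
  (existsUnique_parallel l p).choose_spec.1.1

theorem parallel_parallelThrough (l : L) (p : P) : Parallel l (parallelThrough l p) :=
  (existsUnique_parallel l p).choose_spec.1.2

/-- The intersection point of two lines that are not parallel. -/
noncomputable def meet (l m : L) (h : ¬ Parallel l m) : P := (existsUnique_meet h).choose

theorem meet_mem_left {l m : L} (h : ¬ Parallel l m) : meet l m h ∈ l :=
  (existsUnique_meet h).choose_spec.1.1

theorem meet_mem_right {l m : L} (h : ¬ Parallel l m) : meet l m h ∈ m :=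
  (existsUnique_meet h).choose_spec.1.2

variable (P L) in
/-- Desargues' axiom: the lines `AA'`, `BB'`, `CC'` are parallel or concurrent, and `AB ∥ A'B'`
and `BC ∥ B'C'`; then `AC ∥ A'C'`. -/
def DesarguesAxiom : Prop :=
  ∀ (A B C A' B' C' : P)
    (hA : A ≠ A') (hB : B ≠ B') (hC : C ≠ C')
    (hAB : A ≠ B) (hAB' : A' ≠ B') (hBC : B ≠ C) (hBC' : B' ≠ C') (hAC : A ≠ C) (hAC' : A' ≠ C'),
    [join L A A' hA, join L B B' hB, join L C C' hC, join L A C hAC, join L A' C' hAC'].Nodup →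
    (Parallel (join L A A' hA) (join L B B' hB) ∧ Parallel (join L B B' hB) (join L C C' hC) ∨
      ∃ Q : P, Q ∈ join L A A' hA ∧ Q ∈ join L B B' hB ∧ Q ∈ join L C C' hC) →
    Parallel (join L A B hAB) (join L A' B' hAB') →
    Parallel (join L B C hBC) (join L B' C' hBC') →
    join L A B hAB ≠ join L A' B' hAB' →
    join L B C hBC ≠ join L B' C' hBC' →
    Parallel (join L A C hAC) (join L A' C' hAC')

theorem not_parallel_aux {l m n k : L} (h : ¬ Parallel l m) (hn : Parallel l n)
    (hk : Parallel m k) : ¬ Parallel n k :=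
  fun h' => h ((hn.trans h').trans hk.symm)

theorem not_parallel_join {l : L} {x t : P} (hx : x ∈ l) (ht : t ∉ l) :
    ¬ Parallel l (join L x t (ne_of_mem_of_notMem hx ht)) :=
  not_parallel_of_mem hx (left_mem_join _) (right_mem_join _) ht

theorem not_parallel_join_join {l : L} {x y t : P} (hx : x ∈ l) (hy : y ∈ l) (hxy : x ≠ y)
    (ht : t ∉ l) :
    ¬ Parallel (join L y t (ne_of_mem_of_notMem hy ht))
      (join L x t (ne_of_mem_of_notMem hx ht)) := by
  intro h
  have he := h.eq_of_mem (right_mem_join _) (right_mem_join _)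
  have hy' : y ∈ join L x t (ne_of_mem_of_notMem hx ht) := he ▸ left_mem_join _
  have hl := (AffinePlane.existsUnique_line x y hxy).unique ⟨hx, hy⟩
    ⟨left_mem_join (ne_of_mem_of_notMem hx ht), hy'⟩
  exact ht (hl ▸ right_mem_join (ne_of_mem_of_notMem hx ht))

section Operations

variable {l : L}

/-- The last step of both constructions: the intersection with `l` of the line through `Q`
parallel to the line `BT`, where `B` lies on `l` and `T` does not. -/
noncomputable def project (T : P) (hT : T ∉ l) (B : PointsOn l) (Q : P) : PointsOn l :=
  ⟨meet (parallelThrough (join L B.1 T (ne_of_mem_of_notMem B.2 hT)) Q) l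
      (fun h => not_parallel_join B.2 hT (((parallel_parallelThrough _ _).trans h).symm)),
    meet_mem_right _⟩

/-- The sum `A + B` of points of the line `l` with origin `O`, constructed with the auxiliary
point `T`: the line through `T` parallel to `l` meets the line through `A` parallel to `OT`
in `P₁`, and the line through `P₁` parallel to `BT` meets `l` in `A + B`. -/
noncomputable def geomAdd (O : PointsOn l) (T : P) (hT : T ∉ l) (A B : PointsOn l) : PointsOn l :=
  project T hT B
    (meet (parallelThrough l T)
      (parallelThrough (join L O.1 T (ne_of_mem_of_notMem O.2 hT)) A.1)
      (not_parallel_aux (not_parallel_join O.2 hT) (parallel_parallelThrough _ _)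
        (parallel_parallelThrough _ _)))

/-- The product `A · B` of points of the line `l` with origin `O` and unit `I`, constructed with
the auxiliary point `T`: the line through `A` parallel to `IT` meets the line `OT` in `P₁`, and
the line through `P₁` parallel to `BT` meets `l` in `A · B`. -/
noncomputable def geomMul (O I : PointsOn l) (hOI : O ≠ I) (T : P) (hT : T ∉ l)
    (A B : PointsOn l) : PointsOn l :=
  project T hT B
    (meet (parallelThrough (join L I.1 T (ne_of_mem_of_notMem I.2 hT)) A.1)
      (join L O.1 T (ne_of_mem_of_notMem O.2 hT))
      (not_parallel_aux
        (not_parallel_join_join O.2 I.2 (fun h => hOI (Subtype.ext h)) hT)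
        (parallel_parallelThrough _ _) (Or.inl rfl)))

end Operations

end Plane

/-- The ratio map `r_BC`, `X ↦ r(X, B; C) = (B - C)⁻¹ (X - C)`, in a skew field. -/
def ratioMap {K : Type u} [DivisionRing K] (B C X : K) : K := (B - C)⁻¹ * (X - C)

/-- The set of all ratios `r_BC(X)`. -/
def ratioSet {K : Type u} [DivisionRing K] (B C : K) : Set K := Set.range (ratioMap B C)

end DesarguesGeometry

/-! Coordinates are built from dilatations, maps sending each pair of points to a parallel pair.
Desargues' axiom supplies enough of them through `exists_map_of_pencil`: translations taking any
point to any point (`exists_translation`), and dilatations fixing O that take A ≠ O to any point of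
the line OA (`exists_homothety`). Translations turn the plane into an abelian group with zero O. Its
endomorphisms carrying each line through O into itself are the dilatations fixing O, and they form a
skew field D.

Evaluation at I identifies D with ℓ. Under this identification the two constructions give the group
sum A + B and the image f(B), where f in D has f(I) = A. Neither mentions T, so independence of T
and the skew field laws come together in `exists_divisionRing`.

For B ≠ C the map X ↦ (B - C)⁻¹(X - C) is onto, so the set of ratios is all of ℓ
(`ratioSet_eq_univ`) and the remaining claims are immediate. -/

namespace DesarguesGeometry

/-! ### Calculus of parallel pairs of points -/

section ParCalculus

universe u v
variable {P : Type u} {L : Type v} [Membership P L]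

variable (L) in
/-- The pairs of points `p, q` and `r, s` lie on parallel lines. This holds as soon as
`p = q` or `r = s`. -/
def Par (p q r s : P) : Prop :=
  ∃ m n : L, p ∈ m ∧ q ∈ m ∧ r ∈ n ∧ s ∈ n ∧ Parallel m n

theorem Par.symm {p q r s : P} (h : Par L p q r s) : Par L r s p q := by
  obtain ⟨m, n, hp, hq, hr, hs, hmn⟩ := h
  exact ⟨n, m, hr, hs, hp, hq, hmn.symm⟩

theorem Par.swap_left {p q r s : P} (h : Par L p q r s) : Par L q p r s := by
  obtain ⟨m, n, hp, hq, hr, hs, hmn⟩ := h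
  exact ⟨m, n, hq, hp, hr, hs, hmn⟩

theorem Par.swap_right {p q r s : P} (h : Par L p q r s) : Par L p q s r :=
  h.symm.swap_left.symm

/-- `Par L p q p r` says that `p`, `q` and `r` are collinear. -/
theorem par_iff_collinear {p q r : P} : Par L p q p r ↔ ∃ m : L, p ∈ m ∧ q ∈ m ∧ r ∈ m := by
  constructor
  · rintro ⟨m, n, hp, hq, hr, hs, hmn⟩
    obtain rfl := hmn.eq_of_mem hp hr
    exact ⟨m, hp, hq, hs⟩
  · rintro ⟨m, hp, hq, hr⟩
    exact ⟨m, m, hp, hq, hp, hr, Or.inl rfl⟩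

theorem Par.rotate {p q r : P} (h : Par L p q p r) : Par L q p q r := by
  obtain ⟨m, hp, hq, hr⟩ := par_iff_collinear.1 h
  exact par_iff_collinear.2 ⟨m, hq, hp, hr⟩

variable [AffinePlane P L]

theorem line_unique {p q : P} (h : p ≠ q) {m n : L} (hpm : p ∈ m) (hqm : q ∈ m) (hpn : p ∈ n)
    (hqn : q ∈ n) : m = n :=
  (AffinePlane.existsUnique_line p q h).unique ⟨hpm, hqm⟩ ⟨hpn, hqn⟩

variable (L) in
theorem exists_line (p q : P) : ∃ m : L, p ∈ m ∧ q ∈ m := by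
  by_cases h : p = q
  · obtain ⟨a, b, -, hab, -⟩ := AffinePlane.exists_noncollinear (P := P) (L := L)
    subst h
    by_cases ha : p = a
    · obtain ⟨m, hm, -⟩ := AffinePlane.existsUnique_line (L := L) p b (by rw [ha]; exact hab)
      exact ⟨m, hm.1, hm.1⟩
    · obtain ⟨m, hm, -⟩ := AffinePlane.existsUnique_line (L := L) p a ha
      exact ⟨m, hm.1, hm.1⟩
  · exact (AffinePlane.existsUnique_line p q h).exists

variable (L) in
theorem par_same_left (p r s : P) : Par L p p r s := by
  obtain ⟨n, hr, hs⟩ := exists_line L r s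
  exact ⟨_, n, mem_parallelThrough n p, mem_parallelThrough n p, hr, hs,
    (parallel_parallelThrough n p).symm⟩

variable (L) in
theorem par_same_right (p q r : P) : Par L p q r r := (par_same_left L r p q).symm

variable (L) in
theorem par_refl (p q : P) : Par L p q p q := by
  obtain ⟨n, hr, hs⟩ := exists_line L p q
  exact ⟨n, n, hr, hs, hr, hs, Or.inl rfl⟩

/-- Distinctness of the middle pair is essential, because a degenerate pair is parallel to
everything. -/
theorem Par.trans {p q r s t u : P} (h : Par L p q r s) (hrs : r ≠ s) (h' : Par L r s t u) :
    Par L p q t u := by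
  obtain ⟨m, n, hp, hq, hr, hs, hmn⟩ := h
  obtain ⟨m', n', hr', hs', ht, hu, hmn'⟩ := h'
  obtain rfl := line_unique hrs hr hs hr' hs'
  exact ⟨m, n', hp, hq, ht, hu, hmn.trans hmn'⟩

/-- If `xy` and `xz` are parallel to `ab`, then so is `yz`. -/
theorem Par.third {a b x y z : P} (hab : a ≠ b) (h : Par L a b x y) (h' : Par L a b x z) :
    Par L a b y z := by
  obtain ⟨m, n, ha, hb, hx, hy, hmn⟩ := h
  obtain ⟨m', n', ha', hb', hx', hz, hmn'⟩ := h'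
  obtain rfl := line_unique hab ha hb ha' hb'
  obtain rfl := (hmn.symm.trans hmn').eq_of_mem hx hx'
  exact ⟨m, n, ha, hb, hy, hz, hmn⟩

theorem ne_of_not_par_left {p q r s : P} (h : ¬ Par L p q r s) : p ≠ q := by
  rintro rfl
  exact h (par_same_left L _ _ _)

theorem ne_of_not_par_right {p q r s : P} (h : ¬ Par L p q r s) : r ≠ s := by
  rintro rfl
  exact h (par_same_right L _ _ _)

/-- Lines in two different directions meet at most once. With `exists_par`, this replaces explicit
intersections of lines. -/
theorem eq_of_par {a b c d x y z z' : P} (h : ¬ Par L a b c d) (hx : Par L a b x z)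
    (hx' : Par L a b x z') (hy : Par L c d y z) (hy' : Par L c d y z') : z = z' := by
  by_contra hz
  exact h ((hx.third (ne_of_not_par_left h) hx').trans hz
    (hy.third (ne_of_not_par_right h) hy').symm)

theorem exists_par {a b c d : P} (h : ¬ Par L a b c d) (x y : P) :
    ∃ z, Par L a b x z ∧ Par L c d y z := by
  obtain ⟨m, ha, hb⟩ := exists_line L a b
  obtain ⟨n, hc, hd⟩ := exists_line L c d
  have hmn : ¬ Parallel m n := fun hmn => h ⟨m, n, ha, hb, hc, hd, hmn⟩
  have := not_parallel_aux hmn (parallel_parallelThrough m x) (parallel_parallelThrough n y)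
  exact ⟨meet _ _ this,
    ⟨m, _, ha, hb, mem_parallelThrough m x, meet_mem_left this, parallel_parallelThrough m x⟩,
    ⟨n, _, hc, hd, mem_parallelThrough n y, meet_mem_right this, parallel_parallelThrough n y⟩⟩

variable (L) in
theorem exists_not_par {p q : P} (h : p ≠ q) : ∃ r, ¬ Par L p q p r := by
  obtain ⟨m, hp, hq⟩ := exists_line L p q
  obtain ⟨a, b, c, -, -, -, habc⟩ := AffinePlane.exists_noncollinear (P := P) (L := L)
  by_contra! H
  have key : ∀ r, r ∈ m := fun r => by
    obtain ⟨n, hp', hq', hr⟩ := par_iff_collinear.1 (H r)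
    rwa [line_unique h hp hq hp' hq']
  exact habc ⟨m, key a, key b, key c⟩

theorem par_iff_parallel_join {p q r s : P} (h : p ≠ q) (h' : r ≠ s) :
    Par L p q r s ↔ Parallel (join L p q h) (join L r s h') := by
  constructor
  · rintro ⟨m, n, hp, hq, hr, hs, hmn⟩
    rwa [line_unique h (left_mem_join h) (right_mem_join h) hp hq,
      line_unique h' (left_mem_join h') (right_mem_join h') hr hs]
  · exact fun H => ⟨_, _, left_mem_join h, right_mem_join h, left_mem_join h',
      right_mem_join h', H⟩

end ParCalculus

/-! ### Dilatations and their rigidity -/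

section Dilatation

universe u v
variable {P : Type u} {L : Type v} [Membership P L]

variable (L) in
/-- Maps taking every pair of points to a parallel, possibly degenerate, pair. -/
def IsDilatation (f : P → P) : Prop := ∀ p q, Par L p q (f p) (f q)

variable [AffinePlane P L]

variable (L) in
theorem IsDilatation.id : IsDilatation L (id : P → P) := fun p q => par_refl L p q

variable (L) in
theorem IsDilatation.const (c : P) : IsDilatation L (fun _ : P => c) :=
  fun p q => par_same_right L p q c

theorem IsDilatation.comp {f g : P → P} (hf : IsDilatation L f) (hg : IsDilatation L g) :
    IsDilatation L (f ∘ g) := fun p q => by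
  by_cases h : g p = g q
  · simp only [Function.comp, h]
    exact par_same_right L _ _ _
  · exact (hg p q).trans h (hf _ _)

/-- The image of r lies on the parallels to pr and qr through the images of p and q, and these have
different directions. -/
theorem IsDilatation.eq_of_eq_of_not_par {f g : P → P} (hf : IsDilatation L f)
    (hg : IsDilatation L g) {p q r : P} (hp : f p = g p) (hq : f q = g q)
    (hr : ¬ Par L p q p r) : f r = g r := by
  refine eq_of_par (L := L) (a := p) (b := r) (c := q) (d := r) (x := f p) (y := f q)
    (fun h => hr ?_) (hf _ _) (hp ▸ hg _ _) (hf _ _) (hq ▸ hg _ _)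
  exact h.swap_left.swap_right.rotate.symm

/-- A dilatation is determined by the images of two points. -/
theorem IsDilatation.ext {f g : P → P} (hf : IsDilatation L f)
    (hg : IsDilatation L g) {p q : P} (hpq : p ≠ q) (hp : f p = g p) (hq : f q = g q) :
    f = g := by
  funext r
  -- Points of the line pq itself are reached from p and an auxiliary point s off it, where the maps
  -- already agree.
  obtain ⟨s, hs⟩ := exists_not_par L hpq
  by_cases hr : Par L p q p r
  · by_cases hrp : r = p
    · rw [hrp, hp]
    · exact hf.eq_of_eq_of_not_par hg hp (hf.eq_of_eq_of_not_par hg hp hq hs)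
        (fun h => hs (hr.trans (Ne.symm hrp) h.symm))
  · exact hf.eq_of_eq_of_not_par hg hp hq hr

end Dilatation

/-! ### Desargues' axiom and dilatations along a pencil -/

section Pencil

universe u v
variable {P : Type u} {L : Type v} [Membership P L]

/-- Desargues' axiom for a pencil of parallel or concurrent lines, given by the relation `R` of
lying on the same line of the pencil. -/
theorem DesarguesAxiom.par_of_pencil [AffinePlane P L] (hD : DesarguesAxiom P L) {R : P → P → Prop}
    (symm : ∀ {p q}, R p q → R q p) (trans : ∀ {p q r}, R p q → R q r → R p r)
    (col : ∀ {p p' q}, R p p' → p ≠ p' → R q q → Par L p p' p q → R p q)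
    (pencil : (∀ p p' q q', R p p' → R q q' → Par L p p' q q') ∨
      ∃ O, ∀ p p', R p p' → Par L p p' p O)
    {p q r p' q' r' : P} (hp : R p p') (hq : R q q') (hr : R r r')
    (hpp : p ≠ p') (hqq : q ≠ q') (hrr : r ≠ r') (hpq : ¬ R p q) (hqr : ¬ R q r) (hpr : ¬ R p r)
    (h₁ : Par L p q p' q') (h₂ : Par L q r q' r') : Par L p r p' r' := by
  have ne_of : ∀ {x y : P}, R x x → ¬ R x y → x ≠ y := by
    rintro x y hx hxy rfl
    exact hxy hx
  have left : ∀ {x x'}, R x x' → R x x := fun h => trans h (symm h)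
  have right : ∀ {x x'}, R x x' → R x' x' := fun h => trans (symm h) h
  have move : ∀ {x x' y y'}, R x x' → R y y' → ¬ R x y → ¬ R x' y' :=
    fun h h' hn hxy => hn (trans h (trans hxy (symm h')))
  have notMem : ∀ {x x' y : P} {m : L}, R x x' → x ≠ x' → R y y → ¬ R x y → x ∈ m → x' ∈ m →
      y ∉ m := fun h hne hy hxy hx hx' hym =>
    hxy (col h hne hy (par_iff_collinear.2 ⟨_, hx, hx', hym⟩))
  have hpq0 := ne_of (left hp) hpq
  have hqr0 := ne_of (left hq) hqr
  have hpr0 := ne_of (left hp) hpr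
  have hpq1 := ne_of (right hp) (move hp hq hpq)
  have hqr1 := ne_of (right hq) (move hq hr hqr)
  have hpr1 := ne_of (right hp) (move hp hr hpr)
  have hqp : ¬ R q p := fun h => hpq (symm h)
  have hrp : ¬ R r p := fun h => hpr (symm h)
  have npq : ¬ R p q' := fun h => hpq (trans h (symm hq))
  have npr : ¬ R p r' := fun h => hpr (trans h (symm hr))
  have nqr : ¬ R q r' := fun h => hqr (trans h (symm hr))
  have nqp : ¬ R q p' := fun h => hqp (trans h (symm hp))
  have nrp : ¬ R r p' := fun h => hrp (trans h (symm hp))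
  rw [par_iff_parallel_join hpr0 hpr1]
  -- The axiom asks for these two lines to be distinct; if they coincide, they are parallel anyway.
  by_cases heq : join L p r hpr0 = join L p' r' hpr1
  · exact Or.inl heq
  refine hD p q r p' q' r' hpp hqq hrr hpq0 hpq1 hqr0 hqr1 hpr0 hpr1 ?_ ?_
    ((par_iff_parallel_join _ _).1 h₁) ((par_iff_parallel_join _ _).1 h₂) ?_ ?_
  · simp only [List.nodup_cons, List.mem_cons, List.not_mem_nil, not_or, or_false, not_false_eq_true,
      List.nodup_nil, and_true]
    have hp0 := left_mem_join (L := L) hpp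
    have hp1 := right_mem_join (L := L) hpp
    have hq0 := left_mem_join (L := L) hqq
    have hq1 := right_mem_join (L := L) hqq
    have hr0 := left_mem_join (L := L) hrr
    have hr1 := right_mem_join (L := L) hrr
    refine ⟨⟨?_, ?_, ?_, ?_⟩, ⟨?_, ?_, ?_⟩, ⟨?_, ?_⟩, heq⟩ <;> intro h
    · exact notMem hp hpp (left hq) hpq hp0 hp1 (h ▸ hq0)
    · exact notMem hp hpp (left hr) hpr hp0 hp1 (h ▸ hr0)
    · exact notMem hp hpp (left hr) hpr hp0 hp1 (h ▸ right_mem_join hpr0)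
    · exact notMem hp hpp (right hr) npr hp0 hp1 (h ▸ right_mem_join hpr1)
    · exact notMem hq hqq (left hr) hqr hq0 hq1 (h ▸ hr0)
    · exact notMem hq hqq (left hr) hqr hq0 hq1 (h ▸ right_mem_join hpr0)
    · exact notMem hq hqq (right hr) nqr hq0 hq1 (h ▸ right_mem_join hpr1)
    · exact notMem hr hrr (left hp) hrp hr0 hr1 (h ▸ left_mem_join hpr0)
    · exact notMem hr hrr (right hp) nrp hr0 hr1 (h ▸ left_mem_join hpr1)
  · rcases pencil with h | ⟨O, h⟩
    · exact Or.inl ⟨(par_iff_parallel_join _ _).1 (h _ _ _ _ hp hq),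
        (par_iff_parallel_join _ _).1 (h _ _ _ _ hq hr)⟩
    · have mem : ∀ {x x'} (hx : R x x') (hxx : x ≠ x'), O ∈ join L x x' hxx := fun hx hxx => by
        obtain ⟨m, h0, h1, h2⟩ := par_iff_collinear.1 (h _ _ hx)
        rwa [line_unique hxx (left_mem_join hxx) (right_mem_join hxx) h0 h1]
      exact Or.inr ⟨O, mem hp hpp, mem hq hqq, mem hr hrr⟩
  · intro h
    exact notMem hp hpp (left hq) hpq (left_mem_join hpq0) (h ▸ left_mem_join hpq1)
      (right_mem_join hpq0)
  · intro h
    exact notMem hq hqq (left hr) hqr (left_mem_join hqr0) (h ▸ left_mem_join hqr1)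
      (right_mem_join hqr0)

/-- A pencil with at least three lines carries dilatations moving any point to any other point
of its line. -/
theorem exists_map_of_pencil {R : P → P → Prop}
    (symm : ∀ {p q}, R p q → R q p) (trans : ∀ {p q r}, R p q → R q r → R p r)
    (des : ∀ {p q r p' q' r' : P}, R p p' → R q q' → R r r' → p ≠ p' → q ≠ q' → r ≠ r' →
      ¬ R p q → ¬ R q r → ¬ R p r → Par L p q p' q' → Par L q r q' r' → Par L p r p' r')
    (exist : ∀ {p p' q : P}, R p p' → p ≠ p' → R q q → ¬ R p q →
      ∃ q', R q q' ∧ q ≠ q' ∧ Par L p q p' q')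
    (uniq : ∀ {p q p' x y : P}, R p p → ¬ R p q → R q x → R q y → Par L p q p' x →
      Par L p q p' y → x = y)
    (same : ∀ {p q p' q' : P}, R p q → R p p' → R q q' → Par L p q p' q')
    {A A' T U : P} (hA : R A A') (hAA : A ≠ A') (hT : R T T) (hU : R U U) (hAT : ¬ R A T)
    (hAU : ¬ R A U) (hTU : ¬ R T U) :
    ∃ f : P → P, f A = A' ∧ ∀ p, R p p → R p (f p) ∧ p ≠ f p ∧
      ∀ q, R q q → Par L p q (f p) (f q) := by
  obtain ⟨T', hT', hTT, hATp⟩ := exist hA hAA hT hAT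
  have left : ∀ {x x'}, R x x' → R x x := fun h => trans h (symm h)
  -- The pair A, A' determines images off the line of A, and T, T' serves for points on that line.
  -- Where both apply, Desargues makes them agree.
  have ex : ∀ q, ∃ q', R q q → R q q' ∧ q ≠ q' ∧ (¬ R A q → Par L A q A' q') ∧
      (¬ R T q → Par L T q T' q') := by
    intro q
    by_cases hq : R q q
    swap
    · exact ⟨q, fun h => absurd h hq⟩
    by_cases hAq : R A q
    · have hTq : ¬ R T q := fun h => hAT (trans hAq (symm h))
      obtain ⟨q', h1, h2, h3⟩ := exist hT' hTT hq hTq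
      exact ⟨q', fun _ => ⟨h1, h2, fun h => absurd hAq h, fun _ => h3⟩⟩
    · obtain ⟨q', h1, h2, h3⟩ := exist hA hAA hq hAq
      exact ⟨q', fun _ => ⟨h1, h2, fun _ => h3, fun h => des hT' hA h1 hTT hAA h2
        (fun h' => hAT (symm h')) hAq h hATp.swap_left.swap_right h3⟩⟩
  choose f hf using ex
  have flip : ∀ {a b c d : P}, Par L a b c d → Par L b a d c := fun h => h.swap_left.swap_right
  have hns : ∀ {p q}, ¬ R p q → ¬ R q p := fun h h' => h (symm h')
  refine ⟨f, ?_, fun p hp => ⟨(hf p hp).1, (hf p hp).2.1, ?_⟩⟩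
  · have hA0 := left hA
    exact uniq hT (hns hAT) (hf A hA0).1 hA ((hf A hA0).2.2.2 (hns hAT)) (flip hATp)
  -- the case of points on the lines of `A` and `T`
  have cross : ∀ q r, R q q → R r r → R A q → ¬ R A r → ¬ R q r → Par L q r (f q) (f r) := by
    intro q r hq hr hAq hAr hqr
    obtain ⟨q1, q2, -, q3⟩ := hf q hq
    obtain ⟨r1, r2, r3, r4⟩ := hf r hr
    have hTq : ¬ R T q := fun h => hAT (trans hAq (symm h))
    by_cases hTr : R T r
    -- With q on the line of A and r on that of T, neither base point is off both lines. The point U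
    -- on a third line mediates: Ur is compared through A, qU through T, and then qr through U.
    · obtain ⟨u1, u2, u3, u4⟩ := hf U hU
      have hUr : ¬ R U r := fun h => hTU (trans hTr (symm h))
      have hqU : ¬ R q U := fun h => hAU (trans hAq h)
      have h1 : Par L U r (f U) (f r) :=
        des u1 hA r1 u2 hAA r2 (hns hAU) hAr hUr (flip (u3 hAU)) (r3 hAr)
      have h2 : Par L q U (f q) (f U) :=
        des q1 hT' u1 q2 hTT u2 (hns hTq) hTU hqU (flip (q3 hTq)) (u4 hTU)
      exact des q1 u1 r1 q2 u2 r2 hqU hUr hqr h2 h1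
    · exact des q1 hT' r1 q2 hTT r2 (hns hTq) hTr hqr (flip (q3 hTq)) (r4 hTr)
  intro q hq
  by_cases hpq : R p q
  · exact same hpq (hf p hp).1 (hf q hq).1
  by_cases hAp : R A p
  · exact cross p q hp hq hAp (fun h => hpq (trans (symm hAp) h)) hpq
  by_cases hAq : R A q
  · exact flip (cross q p hq hp hAq hAp (hns hpq))
  · exact des (hf p hp).1 hA (hf q hq).1 (hf p hp).2.1 hAA (hf q hq).2.1 (hns hAp) hAq hpq
      (flip ((hf p hp).2.2.1 hAp)) ((hf q hq).2.2.1 hAq)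

end Pencil
end DesarguesGeometry
namespace DesarguesGeometry
-- Existence of translations and homotheties
section Existence

universe u v
variable {P : Type u} {L : Type v} [Membership P L] [AffinePlane P L]

variable (L) in
/-- Translations are the identity and the dilatations without fixed point. -/
def IsTranslation (f : P → P) : Prop := IsDilatation L f ∧ (f = id ∨ ∀ p, f p ≠ p)

/-- A plane with only two lines in some direction has translations in this direction. -/
theorem exists_translation_of_two_lines {A A' T : P} (hAA : A ≠ A') (hT : ¬ Par L A A' A T)
    (h : ∀ x, Par L A A' A x ∨ Par L A A' T x) :
    ∃ f : P → P, f A = A' ∧ IsTranslation L f := by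
  have trans : ∀ {p q r}, Par L A A' p q → Par L A A' q r → Par L A A' p r :=
    fun h h' => h.swap_right.third hAA h'
  have ex : ∀ p, ∃ p', p ≠ p' ∧ Par L A A' p p' := by
    intro p
    rcases h p with hp | hp
    · by_cases hpA : p = A
      · exact ⟨A', hpA ▸ hAA, hpA ▸ par_refl L A A'⟩
      · exact ⟨A, hpA, hp.swap_right⟩
    · obtain ⟨T', h1, h2⟩ := exists_par hT T A'
      have hTT : T ≠ T' := by
        rintro rfl
        exact hT h2.swap_left.swap_right.symm.rotate.symm.rotate
      by_cases hpT : p = T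
      · exact ⟨T', hpT ▸ hTT, hpT ▸ h1⟩
      · exact ⟨T, hpT, hp.swap_right⟩
  choose g hg using ex
  classical
  let f := Function.update g A A'
  have hf : ∀ p, p ≠ f p ∧ Par L A A' p (f p) := by
    intro p
    by_cases hp : p = A
    · subst hp
      simpa [f] using ⟨hAA, par_refl L p A'⟩
    · simpa [f, Function.update_of_ne hp] using hg p
  refine ⟨f, by simp [f], fun p q => ?_, Or.inr fun p => (hf p).1.symm⟩
  have hp := hf p
  have hq := hf q
  by_cases hpq : Par L A A' p q
  · exact hpq.symm.trans hAA (trans (trans hp.2.swap_right hpq) hq.2)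
  by_contra hn
  -- Any map moving every point within its own line works here. If pq and f(p)f(q) met in z, then z
  -- would lie on the line of p or of q, hence equal p or q; as f has no fixed point, f(p)f(q) would
  -- have the direction AA', putting p and q on one line.
  obtain ⟨z, hz1, hz2⟩ := exists_par hn p (f p)
  have hpqz := hz1.rotate
  have hz2' := hz2.rotate
  have class_of : Par L A A' p z ∨ Par L A A' q z := by
    rcases h p with h1 | h1 <;> rcases h q with h2 | h2 <;> rcases h z with h3 | h3
    · exact Or.inl (trans h1.swap_right h3)
    · exact absurd (trans h1.swap_right h2) hpq
    · exact Or.inl (trans h1.swap_right h3)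
    · exact Or.inr (trans h2.swap_right h3)
    · exact Or.inr (trans h2.swap_right h3)
    · exact Or.inl (trans h1.swap_right h3)
    · exact absurd (trans h1.swap_right h2) hpq
    · exact Or.inl (trans h1.swap_right h3)
  rcases class_of with hz | hz
  · have e : z = p := by
      by_contra e
      exact hpq (hz.trans (Ne.symm e) hz1.symm)
    subst e
    exact hpq (trans (trans hp.2 (hp.2.swap_right.trans hp.1.symm hz2.symm)) hq.2.swap_right)
  · have e : z = q := by
      by_contra e
      exact hpq ((hz.trans (Ne.symm e) hpqz.symm).swap_right)
    subst e
    exact hpq (trans (trans hp.2 (hq.2.swap_right.trans hq.1.symm hz2'.symm).swap_right)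
      hq.2.swap_right)

/-- The pencil of parallels to AA' yields the map when it has three lines. With only two lines
Desargues' axiom gives no leverage, and a direct argument takes over. -/
theorem exists_translation (hD : DesarguesAxiom P L) (A A' : P) :
    ∃ f : P → P, f A = A' ∧ IsTranslation L f := by
  by_cases hAA : A = A'
  · exact ⟨id, hAA, IsDilatation.id L, Or.inl rfl⟩
  obtain ⟨T, hT⟩ := exists_not_par L hAA
  by_cases hU : ∀ x, Par L A A' A x ∨ Par L A A' T x
  · exact exists_translation_of_two_lines hAA hT hU
  push Not at hU
  obtain ⟨U, hAU, hTU⟩ := hU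
  have trans : ∀ {p q r}, Par L A A' p q → Par L A A' q r → Par L A A' p r :=
    fun h h' => h.swap_right.third hAA h'
  obtain ⟨f, hfA, hf⟩ := exists_map_of_pencil (L := L) (R := fun p q => Par L A A' p q)
    (A := A) (A' := A') (T := T) (U := U) (fun h => h.swap_right) trans
    (hD.par_of_pencil (R := fun p q => Par L A A' p q) (fun h => h.swap_right) trans (fun h hn _ h' => h.trans hn h')
      (Or.inl fun p p' q q' h h' => h.symm.trans hAA h'))
    (fun {p p' q} hp hpp hq hpq => by
      obtain ⟨z, h1, h2⟩ := exists_par hpq q p'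
      refine ⟨z, h1, ?_, h2⟩
      rintro rfl
      refine hpq (hp.trans hpp ?_)
      exact h2.swap_left.swap_right.rotate.symm)
    (fun _ hpq h1 h2 h3 h4 => eq_of_par hpq h1 h2 h3 h4)
    (fun h h1 h2 => h.symm.trans hAA (trans (trans h1.swap_right h) h2))
    (par_refl L A A') hAA (par_same_right L _ _ _) (par_same_right L _ _ _) hT hAU hTU
  exact ⟨f, hfA, fun p q => (hf p (par_same_right L _ _ _)).2.2 q (par_same_right L _ _ _),
    Or.inr fun p => (hf p (par_same_right L _ _ _)).2.1.symm⟩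

/-- The pencil of lines through O is used. A third line besides OA and OT always exists, namely the
parallel to AT, so there is no exceptional case as for translations. -/
theorem exists_homothety (hD : DesarguesAxiom P L) {O A A' : P} (hA : A ≠ O)
    (hOA : Par L O A O A') : ∃ f : P → P, f O = O ∧ f A = A' ∧ IsDilatation L f := by
  by_cases hA' : A' = O
  · exact ⟨fun _ => O, rfl, hA'.symm, IsDilatation.const L O⟩
  by_cases hAA : A = A'
  · exact ⟨id, rfl, hAA, IsDilatation.id L⟩
  obtain ⟨T, hT⟩ := exists_not_par L (Ne.symm hA)
  have hTO : T ≠ O := (ne_of_not_par_right hT).symm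
  -- a point of the parallel through `O` to `AT`
  obtain ⟨U, hU1, hU2⟩ := exists_par (L := L) (a := A) (b := T) (c := O) (d := A)
    (fun h => hT h.swap_right.symm.rotate) O T
  have hUO : U ≠ O := by
    rintro rfl
    exact hT hU2.swap_right
  have hAU : ¬ Par L O A O U := fun h => hT (h.trans hUO.symm hU1.symm).swap_left.rotate
  have hTU : ¬ Par L O T O U := fun h =>
    hT (h.trans hUO.symm hU1.symm).swap_left.swap_right.rotate.symm
  -- The centre lies on every line of the pencil, so it is excluded to keep the relation transitive;
  -- its image is set to O at the end.
  have symm : ∀ {p q}, p ≠ O ∧ q ≠ O ∧ Par L O p O q → q ≠ O ∧ p ≠ O ∧ Par L O q O p :=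
    fun h => ⟨h.2.1, h.1, h.2.2.symm⟩
  have trans : ∀ {p q r}, p ≠ O ∧ q ≠ O ∧ Par L O p O q → q ≠ O ∧ r ≠ O ∧ Par L O q O r →
      p ≠ O ∧ r ≠ O ∧ Par L O p O r :=
    fun h h' => ⟨h.1, h'.2.1, h.2.2.trans h.2.1.symm h'.2.2⟩
  have refl : ∀ {p}, p ≠ O → p ≠ O ∧ p ≠ O ∧ Par L O p O p := fun h => ⟨h, h, par_refl L _ _⟩
  obtain ⟨f, hfA, hf⟩ := exists_map_of_pencil (L := L)
    (R := fun p q => p ≠ O ∧ q ≠ O ∧ Par L O p O q)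
    (A := A) (A' := A') (T := T) (U := U) symm trans
    (hD.par_of_pencil (R := fun p q => p ≠ O ∧ q ≠ O ∧ Par L O p O q) symm trans
      (fun h hn hq h' => ⟨h.1, hq.1, (h.2.2.rotate.trans hn h').rotate⟩)
      (Or.inr ⟨O, fun p p' h => h.2.2.rotate.symm⟩))
    (fun {p p' q} hp hpp hq hpq => by
      have hpq' : ¬ Par L O p O q := fun h => hpq ⟨hp.1, hq.1, h⟩
      obtain ⟨z, h1, h2⟩ := exists_par (L := L) (a := O) (b := q) (c := p) (d := q)
        (fun h => hpq' h.swap_left.swap_right.rotate.symm) O p'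
      refine ⟨z, ⟨hq.1, ?_, h1⟩, ?_, h2⟩
      · rintro rfl
        exact hpq' (h2.trans hp.2.1 hp.2.2.symm.swap_left).swap_right.symm.rotate
      · rintro rfl
        exact hpq' (hp.2.2.rotate.trans hpp h2.swap_left.swap_right.rotate.symm).rotate)
    (fun {p q p' x y} hp hpq h1 h2 h3 h4 => eq_of_par (L := L) (a := O) (b := q) (c := p) (d := q)
      (fun h => hpq ⟨hp.1, h1.1, h.swap_left.swap_right.rotate.symm⟩) h1.2.2 h2.2.2 h3 h4)
    (fun h h1 h2 => h.2.2.rotate.swap_left.symm.trans h.1.symm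
      (h1.2.2.third h.1.symm (trans h h2).2.2))
    ⟨hA, hA', hOA⟩ hAA (refl hTO) (refl hUO) (fun h => hT h.2.2) (fun h => hAU h.2.2)
    (fun h => hTU h.2.2)
  classical
  refine ⟨fun p => if p = O then O else f p, if_pos rfl, by simp [hA, hfA], fun p q => ?_⟩
  by_cases hp : p = O <;> by_cases hq : q = O
  · simpa [hp, hq] using par_refl L O O
  · simpa [hp, hq] using (hf q (refl hq)).1.2.2
  · simpa [hp, hq] using (hf p (refl hp)).1.2.2.swap_left.swap_right
  · simpa [hp, hq] using (hf p (refl hp)).2.2 q (refl hq)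

end Existence
end DesarguesGeometry
namespace DesarguesGeometry
-- The group of translations
section TranslationGroup

universe u v
variable {P : Type u} {L : Type v} [Membership P L]

theorem IsTranslation.eq_id {f : P → P} (hf : IsTranslation L f) {p : P} (hp : f p = p) :
    f = id :=
  hf.2.resolve_right fun h => h p hp

variable [AffinePlane P L]

theorem IsDilatation.trace_invariant {f : P → P} (hf : IsDilatation L f) {p z : P} (hp : f p ≠ p)
    (hz : Par L p (f p) p z) : Par L p (f p) z (f z) := by
  by_cases h : p = z
  · subst h
    exact par_refl L _ _
  · exact hz.rotate.swap_left.third hp.symm (hz.trans h (hf p z))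

/-- Lines joining a point to its image are invariant. Two that were not parallel would meet in a
point z whose own displacement, being non-zero, would have both directions. -/
theorem IsTranslation.par {f : P → P} (hf : IsTranslation L f) (p q : P) :
    Par L p (f p) q (f q) := by
  rcases hf.2 with rfl | h
  · exact par_same_left L _ _ _
  by_contra hn
  obtain ⟨z, h1, h2⟩ := exists_par hn p q
  exact hn ((hf.1.trace_invariant (h p) h1).trans (h z).symm
    (hf.1.trace_invariant (h q) h2).symm)

/-- A translation is determined by the image of one point. -/
theorem IsTranslation.ext {f g : P → P} (hf : IsTranslation L f) (hg : IsTranslation L g) {p : P}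
    (h : f p = g p) : f = g := by
  by_cases hp : f p = p
  · rw [hf.eq_id hp, hg.eq_id (h ▸ hp)]
  · obtain ⟨r, hr⟩ := exists_not_par L (Ne.symm hp)
    exact hf.1.ext hg.1 (ne_of_not_par_right hr) h
      (eq_of_par hr (hf.par p r) (h ▸ hg.par p r) (hf.1 p r) (h ▸ hg.1 p r))

/-- If f ∘ g fixes p, then f undoes the displacement of g at p. For q off that trace, f(g(q)) lies
on the parallel to the trace through q and on the line pq, so q is fixed too. -/
theorem IsTranslation.comp {f g : P → P} (hf : IsTranslation L f) (hg : IsTranslation L g) :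
    IsTranslation L (f ∘ g) := by
  refine ⟨hf.1.comp hg.1, ?_⟩
  by_cases h : ∃ p, f (g p) = p
  swap
  · exact Or.inr fun p hp => h ⟨p, hp⟩
  left
  obtain ⟨p, hp⟩ := h
  by_cases hgp : g p = p
  · rw [hg.eq_id hgp, hf.eq_id (hgp ▸ hp)]
    rfl
  obtain ⟨q, hq⟩ := exists_not_par L (Ne.symm hgp)
  have h1 : Par L p (g p) (g q) (f (g q)) := by
    have := hf.par (g p) (g q)
    rw [hp] at this
    exact this.swap_left
  have h2 := (hf.1.comp hg.1) p q
  rw [Function.comp, hp] at h2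
  exact (hf.1.comp hg.1).ext (IsDilatation.id L) (ne_of_not_par_right hq) hp
    (eq_of_par hq ((hg.par p q).swap_right.third (Ne.symm hgp) h1) (par_same_right L _ _ _) h2
      (par_refl L p q))

/-- The points of a Desargues plane form an abelian group with any prescribed zero, in which
adding a point is a translation. -/
theorem exists_addCommGroup (hD : DesarguesAxiom P L) (O : P) :
    ∃ _ : AddCommGroup P, 0 = O ∧ ∀ p : P, IsTranslation L (p + ·) := by
  choose τ hτ hτt using exists_translation hD O
  choose σ hσ hσt using fun p => exists_translation hD p O
  let : Add P := ⟨τ⟩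
  let : Zero P := ⟨O⟩
  let : Neg P := ⟨fun p => σ p O⟩
  have assoc : ∀ p q r : P, p + q + r = p + (q + r) := fun p q r =>
    congrFun ((hτt (τ p q)).ext ((hτt p).comp (hτt q)) (p := O)
      (by rw [hτ, Function.comp, hτ])) r
  have zero_add : ∀ p : P, 0 + p = p := fun p => congrFun ((hτt O).eq_id (hτ O)) p
  have neg_add : ∀ p : P, -p + p = 0 := fun p => by
    have : τ (σ p O) = σ p := (hτt _).ext (hσt p) (hτ _)
    exact (congrFun this p).trans (hσ p)
  let : AddGroup P := AddGroup.ofLeftAxioms assoc zero_add neg_add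
  have tr : ∀ p : P, IsTranslation L (p + ·) := hτt
  have par : ∀ p r : P, Par L 0 p r (p + r) := fun p r => by simpa using (tr p).par 0 r
  have dil : ∀ p r : P, Par L 0 p r (r + p) := fun p r => by simpa using (tr r).1 0 p
  have comm_of : ∀ p r : P, ¬ Par L 0 p 0 r → p + r = r + p := fun p r h =>
    eq_of_par h (par p r) (dil p r) (dil r p) (par r p)
  refine ⟨{ add_comm := fun p r => ?_ }, rfl, tr⟩
  by_cases hp : p = 0
  · rw [hp, _root_.zero_add, add_zero]
  by_cases h : Par L 0 p 0 r
  swap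
  · exact comm_of p r h
  -- For r on the line 0p, take s off it. Then r + s is also off it, so p commutes with s and r + s,
  -- and s cancels.
  obtain ⟨s, hs⟩ := exists_not_par L (Ne.symm hp)
  have hs0 : s ≠ 0 := (ne_of_not_par_right hs).symm
  have hrs : ¬ Par L 0 p 0 (r + s) := fun h' =>
    hs ((h.third (Ne.symm hp) h').trans (by simpa using hs0) (dil s r).symm)
  have h1 := comm_of p _ hrs
  rw [add_assoc, ← comm_of p s hs, ← add_assoc, ← add_assoc] at h1
  exact add_right_cancel h1

end TranslationGroup

/-! ### Trace-preserving endomorphisms -/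

section Endomorphisms

universe u v
variable {P : Type u} {L : Type v} [Membership P L] [AffinePlane P L] [AddCommGroup P]

theorem par_add_left (hP : ∀ p : P, IsTranslation L (p + ·)) (p r : P) : Par L 0 p r (p + r) := by
  simpa using (hP p).par 0 r

theorem par_add (hP : ∀ p : P, IsTranslation L (p + ·)) {x y z : P} (hy : Par L 0 x 0 y)
    (hz : Par L 0 x 0 z) : Par L 0 x 0 (y + z) := by
  by_cases hx : x = 0
  · rw [hx]
    exact par_same_left L _ _ _
  by_cases hy0 : y = 0
  · rwa [hy0, zero_add]
  exact hz.swap_right.third (Ne.symm hx) (hy.trans (Ne.symm hy0) (par_add_left hP y z))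

theorem par_neg (hP : ∀ p : P, IsTranslation L (p + ·)) {x y : P} (hy : Par L 0 x 0 y) :
    Par L 0 x 0 (-y) := by
  by_cases hy0 : y = 0
  · subst hy0
    rwa [neg_zero]
  · have := hy.trans (Ne.symm hy0) (par_add_left hP y (-y))
    rw [add_neg_cancel] at this
    exact this.swap_right

/-- The endomorphisms of the group of points that map every line through `0` into itself. -/
def tracePreserving (hP : ∀ p : P, IsTranslation L (p + ·)) : Subring (AddMonoid.End P) where
  carrier := {f | ∀ x, Par L 0 x 0 (f x)}
  zero_mem' x := par_same_right L _ _ _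
  one_mem' x := par_refl L _ _
  add_mem' hf hg x := par_add hP (hf x) (hg x)
  neg_mem' hf x := par_neg hP (hf x)
  mul_mem' {f g} hf hg x := by
    by_cases h : g x = 0
    · simpa [h] using par_same_right L 0 x 0
    · exact (hg x).trans (Ne.symm h) (hf _)

/-- Translating to 0 replaces the pair p, q by 0, q - p, and additivity does the same for the
images. -/
theorem isDilatation_of_mem (hP : ∀ p : P, IsTranslation L (p + ·)) {f : AddMonoid.End P}
    (hf : f ∈ tracePreserving hP) : IsDilatation L f := fun p q => by
  by_cases hpq : p = q
  · rw [hpq]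
    exact par_same_left L _ _ _
  by_cases hfpq : f p = f q
  · rw [hfpq]
    exact par_same_right L _ _ _
  have h1 : Par L 0 (q - p) p q := by simpa using (hP p).1 0 (q - p)
  have h2 : Par L 0 (f q - f p) (f p) (f q) := by simpa using (hP (f p)).1 0 (f q - f p)
  have h3 := hf (q - p)
  rw [map_sub] at h3
  exact h1.symm.trans (sub_ne_zero.2 (Ne.symm hpq)).symm
    (h3.trans (sub_ne_zero.2 (Ne.symm hfpq)).symm h2)

/-- Both q ↦ f(p + q) and q ↦ f(p) + f(q) are dilatations. They agree at 0 and, by a parallelogram,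
at a point r off the line 0p. -/
theorem IsDilatation.map_add (hP : ∀ p : P, IsTranslation L (p + ·)) {f : P → P}
    (hf : IsDilatation L f) (h0 : f 0 = 0) (p q : P) : f (p + q) = f p + f q := by
  by_cases hp : p = 0
  · rw [hp, h0, zero_add, zero_add]
  obtain ⟨r, hr⟩ := exists_not_par L (Ne.symm hp)
  have h1 : IsDilatation L (f ∘ (p + ·)) := hf.comp (hP p).1
  have h2 : IsDilatation L ((f p + ·) ∘ f) := (hP (f p)).1.comp hf
  refine congrFun (h1.ext h2 (ne_of_not_par_right hr) (by simp [h0]) ?_) q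
  refine eq_of_par hr (x := f r) (y := f p) ?_ ?_ ?_ ?_
  · exact (par_add_left hP p r).trans (by simpa using hp) (hf _ _)
  · by_cases hfp : f p = 0
    · simp only [Function.comp, hfp, zero_add]
      exact par_same_right L _ _ _
    · have := hf 0 p
      rw [h0] at this
      exact this.trans (Ne.symm hfp) (par_add_left hP _ _)
  · simpa using h1 0 r
  · simpa [h0] using h2 0 r

theorem exists_mem_tracePreserving (hD : DesarguesAxiom P L)
    (hP : ∀ p : P, IsTranslation L (p + ·)) {x y : P} (hx : x ≠ 0) (hxy : Par L 0 x 0 y) :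
    ∃ f ∈ tracePreserving hP, f x = y := by
  obtain ⟨f, h0, hf, hdil⟩ := exists_homothety hD hx hxy
  refine ⟨⟨⟨f, h0⟩, hdil.map_add hP h0⟩, fun z => ?_, hf⟩
  have := hdil 0 z
  rwa [h0] at this

theorem eq_of_mem_tracePreserving (hP : ∀ p : P, IsTranslation L (p + ·)) {f g : AddMonoid.End P}
    (hf : f ∈ tracePreserving hP) (hg : g ∈ tracePreserving hP) {x : P} (hx : x ≠ 0)
    (h : f x = g x) : f = g :=
  DFunLike.coe_injective ((isDilatation_of_mem hP hf).ext (isDilatation_of_mem hP hg) hx.symm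
    (by simp) h)

/-- A homothety taking f(i) back to i composes with f to a map fixing i, hence to the identity. -/
theorem exists_left_inverse (hD : DesarguesAxiom P L) (hP : ∀ p : P, IsTranslation L (p + ·))
    {i : P} (hi : i ≠ 0) {f : AddMonoid.End P} (hf : f ∈ tracePreserving hP) (hf0 : f ≠ 0) :
    ∃ g ∈ tracePreserving hP, g * f = 1 := by
  have hfi : f i ≠ 0 := fun h => hf0 (eq_of_mem_tracePreserving hP hf (zero_mem _) hi h)
  obtain ⟨g, hg, hgf⟩ := exists_mem_tracePreserving hD hP hfi (hf i).symm
  exact ⟨g, hg, eq_of_mem_tracePreserving hP (mul_mem hg hf) (one_mem _) hi hgf⟩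

end Endomorphisms

/-- A ring of endomorphisms in which the non-zero elements have left inverses is transported to a
skew field on the orbit of a point `i` on which it acts freely. -/
theorem exists_divisionRing_of_orbit {G : Type*} [AddCommGroup G] (D : Subring (AddMonoid.End G))
    {i : G} (hi : i ≠ 0) (s : G → Prop) (mem : ∀ f ∈ D, s (f i))
    (inj : ∀ f ∈ D, ∀ g ∈ D, f i = g i → f = g) (surj : ∀ x, s x → ∃ f ∈ D, f i = x)
    (inv : ∀ f ∈ D, f ≠ 0 → ∃ g ∈ D, g * f = 1) :
    ∃ _ : DivisionRing {x // s x}, (∀ x y : {x // s x}, (x + y).1 = x.1 + y.1) ∧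
      (∀ f ∈ D, ∀ x y : {x // s x}, f i = x.1 → (x * y).1 = f y.1) ∧
      (0 : {x // s x}).1 = 0 ∧ (1 : {x // s x}).1 = i := by
  have inv' : ∀ f : D, f ≠ 0 → ∃ g : D, g * f = 1 := fun f hf => by
    obtain ⟨g, hg, h⟩ := inv f.1 f.2 (fun h => hf (Subtype.ext h))
    exact ⟨⟨g, hg⟩, Subtype.ext h⟩
  have : Nontrivial D := ⟨0, 1, fun h => hi (DFunLike.congr_fun (congrArg Subtype.val h) i).symm⟩
  let : DivisionRing D := DivisionRing.ofIsUnitOrEqZero fun f => by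
    by_cases hf : f = 0
    · exact Or.inr hf
    -- The left inverse g has a left inverse of its own, which must be f, so g is two-sided.
    obtain ⟨g, hg⟩ := inv' f hf
    have hg0 : g ≠ 0 := by
      rintro rfl
      simp at hg
    obtain ⟨h, hh⟩ := inv' g hg0
    have : h = f := by rw [← mul_one h, ← hg, ← mul_assoc, hh, one_mul]
    exact Or.inl ⟨⟨f, g, this ▸ hh, hg⟩, rfl⟩
  let e : D ≃ {x // s x} := Equiv.ofBijective (fun f => ⟨f.1 i, mem _ f.2⟩)
    ⟨fun f g h => Subtype.ext (inj _ f.2 _ g.2 (congrArg Subtype.val h)), fun x => by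
      obtain ⟨f, hf, h⟩ := surj x.1 x.2
      exact ⟨⟨f, hf⟩, Subtype.ext h⟩⟩
  have he : ∀ x, (e.symm x).1 i = x.1 := fun x => congrArg Subtype.val (e.apply_symm_apply x)
  refine ⟨e.symm.divisionRing, fun x y => ?_, fun f hf x y h => ?_, rfl, rfl⟩
  · rw [← he x, ← he y]
    rfl
  · obtain rfl : f = (e.symm x).1 := inj _ hf _ (e.symm x).2 (h.trans (he x).symm)
    rw [← he y]
    rfl

/-! ### Comparison with the geometric operations -/

section Construction

universe u v
variable {P : Type u} {L : Type v} [Membership P L] [AffinePlane P L]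

theorem mem_parallelThrough_join {p q r s : P} (hpq : p ≠ q) (h : Par L p q r s) :
    s ∈ parallelThrough (join L p q hpq) r := by
  obtain ⟨m, n, hp, hq, hr, hs, hmn⟩ := h
  obtain rfl := line_unique hpq (left_mem_join hpq) (right_mem_join hpq) hp hq
  rwa [← (existsUnique_parallel _ r).unique ⟨hr, hmn⟩
    ⟨mem_parallelThrough _ r, parallel_parallelThrough _ r⟩]

theorem eq_meet {l m : L} (h : ¬ Parallel l m) {x : P} (hl : x ∈ l) (hm : x ∈ m) :
    x = meet l m h :=
  (existsUnique_meet h).unique ⟨hl, hm⟩ ⟨meet_mem_left h, meet_mem_right h⟩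

variable {l : L}

theorem eq_project {T : P} (hT : T ∉ l) {B X : PointsOn l} {Q : P} (h : Par L B.1 T Q X.1) :
    X = project T hT B Q :=
  Subtype.ext (eq_meet
    (fun h' => not_parallel_join B.2 hT (((parallel_parallelThrough _ _).trans h').symm))
    (mem_parallelThrough_join _ h) X.2)

theorem eq_geomAdd {O I A B X : PointsOn l} (hOI : O ≠ I) {T : P} (hT : T ∉ l)
    {Q : P} (hTQ : Par L O.1 I.1 T Q) (hAQ : Par L O.1 T A.1 Q)
    (h : Par L B.1 T Q X.1) : X = geomAdd O T hT A B := by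
  have hI : O.1 ≠ I.1 := fun h => hOI (Subtype.ext h)
  have hQ := mem_parallelThrough_join hI hTQ
  rw [line_unique hI (left_mem_join hI) (right_mem_join hI) O.2 I.2] at hQ
  refine eq_project hT ?_
  rwa [← eq_meet _ hQ (mem_parallelThrough_join _ hAQ)]

theorem eq_geomMul {O I A B X : PointsOn l} (hOI : O ≠ I) {T : P} (hT : T ∉ l)
    {Q : P} (hTQ : Par L O.1 T O.1 Q) (hAQ : Par L I.1 T A.1 Q)
    (h : Par L B.1 T Q X.1) : X = geomMul O I hOI T hT A B := by
  have hOT := ne_of_mem_of_notMem O.2 hT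
  have hQ : Q ∈ join L O.1 T hOT := by
    obtain ⟨m, h1, h2, h3⟩ := par_iff_collinear.1 hTQ
    rwa [line_unique hOT (left_mem_join hOT) (right_mem_join hOT) h1 h2]
  refine eq_project hT ?_
  rwa [← eq_meet _ (mem_parallelThrough_join _ hAQ) hQ]

/-- The points of a line of a Desargues plane form a skew field under the geometric operations. -/
theorem exists_divisionRing (hD : DesarguesAxiom P L) (O I : PointsOn l) (hOI : O ≠ I) :
    ∃ _ : DivisionRing (PointsOn l),
      (∀ (T : P) (hT : T ∉ l) (X Y : PointsOn l), X + Y = geomAdd O T hT X Y) ∧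
      (∀ (T : P) (hT : T ∉ l) (X Y : PointsOn l), X * Y = geomMul O I hOI T hT X Y) ∧
      0 = O ∧ 1 = I := by
  obtain ⟨_, h0, hP⟩ := exists_addCommGroup hD O.1
  have hI0 : I.1 ≠ 0 := fun h => hOI (Subtype.ext (h0.symm.trans h.symm))
  have mem_iff : ∀ x, x ∈ l ↔ Par L 0 I.1 0 x := fun x => by
    rw [par_iff_collinear]
    constructor
    · exact fun h => ⟨l, h0 ▸ O.2, I.2, h⟩
    · rintro ⟨m, h1, h2, h3⟩
      rwa [line_unique hI0.symm (h0 ▸ O.2) I.2 h1 h2]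
  obtain ⟨inst, hadd, hmul, hzero, hone⟩ := exists_divisionRing_of_orbit (tracePreserving hP) hI0
    (fun x => x ∈ l) (fun f hf => (mem_iff _).2 (hf _))
    (fun f hf g hg h => eq_of_mem_tracePreserving hP hf hg hI0 h)
    (fun x hx => exists_mem_tracePreserving hD hP hI0 ((mem_iff x).1 hx))
    (fun f hf hf0 => exists_left_inverse hD hP hI0 hf hf0)
  refine ⟨inst, fun T hT X Y => ?_, fun T hT X Y => ?_, Subtype.ext (hzero.trans h0),
    Subtype.ext hone⟩
  -- Translation by X sends O, T, Y to X, X + T, X + Y, so X + T is the point P₁.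
  · refine eq_geomAdd hOI hT (Q := X.1 + T) ?_ ?_ ?_
    · rw [← h0]
      by_cases hX : X.1 = 0
      · rw [hX, zero_add]
        exact par_same_right L _ _ _
      · exact ((mem_iff X.1).1 X.2).trans (Ne.symm hX) (par_add_left hP _ _)
    · rw [← h0]
      simpa using (hP X.1).1 0 T
    · rw [hadd]
      exact ((hP X.1).1 Y.1 T).swap_right
  -- The dilatation f sends I, T, Y to X, f(T), XY and keeps T on the line OT, so f(T) is the point
  -- P₁.
  · obtain ⟨f, hf, hfX⟩ := exists_mem_tracePreserving hD hP hI0 ((mem_iff X.1).1 X.2)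
    have hdil := isDilatation_of_mem hP hf
    refine eq_geomMul hOI hT (Q := f T) (h0 ▸ hf T) (hfX ▸ hdil I.1 T) ?_
    rw [hmul f hf X Y hfX]
    exact (hdil Y.1 T).swap_right

end Construction

/-- The ratio map is affine with invertible coefficient, so solving for X gives a preimage of any y.
-/
theorem ratioSet_eq_univ {K : Type*} [DivisionRing K] {B C : K} (h : B ≠ C) :
    ratioSet B C = Set.univ :=
  Set.eq_univ_of_forall fun y => ⟨(B - C) * y + C, by
    rw [ratioMap, add_sub_cancel_right, inv_mul_cancel_left₀ (sub_ne_zero.2 h)]⟩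

end DesarguesGeometry

theorem mainTheorem1 {P : Type*} {L : Type*} [Membership P L]
    [DesarguesGeometry.AffinePlane P L] (hD : DesarguesGeometry.DesarguesAxiom P L)
    (l : L) (O I : DesarguesGeometry.PointsOn l) (hOI : O ≠ I)
    (B C : DesarguesGeometry.PointsOn l) (hBC : B ≠ C) :
    -- the line with its geometric operations is a skew field, with zero `O` and unit `I`
    ∃ _ : DivisionRing (DesarguesGeometry.PointsOn l),
      (∀ (T : P) (hT : T ∉ l) (X Y : DesarguesGeometry.PointsOn l),
        X + Y = DesarguesGeometry.geomAdd O T hT X Y) ∧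
      (∀ (T : P) (hT : T ∉ l) (X Y : DesarguesGeometry.PointsOn l),
        X * Y = DesarguesGeometry.geomMul O I hOI T hT X Y) ∧
      0 = O ∧ 1 = I ∧
      -- the set of ratios is closed under the geometric operations
      (∀ (T : P) (hT : T ∉ l), ∀ R ∈ DesarguesGeometry.ratioSet B C,
        ∀ S ∈ DesarguesGeometry.ratioSet B C,
          DesarguesGeometry.geomAdd O T hT R S ∈ DesarguesGeometry.ratioSet B C ∧
          DesarguesGeometry.geomMul O I hOI T hT R S ∈ DesarguesGeometry.ratioSet B C) ∧
      -- with them it is a skew field, with zero `r_BC(C)` and unit `r_BC(B)`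
      (∃ _ : DivisionRing (DesarguesGeometry.ratioSet B C),
        (∀ (T : P) (hT : T ∉ l) (R S : DesarguesGeometry.ratioSet B C),
          (R + S).1 = DesarguesGeometry.geomAdd O T hT R.1 S.1) ∧
        (∀ (T : P) (hT : T ∉ l) (R S : DesarguesGeometry.ratioSet B C),
          (R * S).1 = DesarguesGeometry.geomMul O I hOI T hT R.1 S.1) ∧
        (0 : DesarguesGeometry.ratioSet B C).1 = DesarguesGeometry.ratioMap B C C ∧
        (1 : DesarguesGeometry.ratioSet B C).1 = DesarguesGeometry.ratioMap B C B) ∧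
      -- it is a sub-skew-field of the line
      ∃ F : Subfield (DesarguesGeometry.PointsOn l),
        (F : Set (DesarguesGeometry.PointsOn l)) = DesarguesGeometry.ratioSet B C := by

  obtain ⟨inst, hadd, hmul, h0, h1⟩ := DesarguesGeometry.exists_divisionRing hD O I hOI
  have huniv := DesarguesGeometry.ratioSet_eq_univ hBC
  have hmem : ∀ X, X ∈ DesarguesGeometry.ratioSet B C := fun X => huniv ▸ Set.mem_univ X
  let F : Subfield (DesarguesGeometry.PointsOn l) :=
    { carrier := DesarguesGeometry.ratioSet B C
      zero_mem' := hmem _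
      one_mem' := hmem _
      add_mem' := fun _ _ => hmem _
      mul_mem' := fun _ _ => hmem _
      neg_mem' := fun _ => hmem _
      inv_mem' := fun _ _ => hmem _ }
  refine ⟨inst, hadd, hmul, h0, h1, fun T hT R _ S _ => ⟨hmem _, hmem _⟩,
    ⟨(inferInstance : DivisionRing F), fun T hT R S => hadd T hT R.1 S.1,
      fun T hT R S => hmul T hT R.1 S.1, ?_, ?_⟩, F, rfl⟩
  · simp only [DesarguesGeometry.ratioMap, sub_self, mul_zero]
    rfl
  · rw [DesarguesGeometry.ratioMap, inv_mul_cancel₀ (sub_ne_zero.2 hBC)]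
    rfl
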